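/- A subset $A\subseteq\mathbb{N}$ (a "real") has density $1$ if $\lim_{n\to\infty}|A\cap\{0,\dots,n-1\}|/n=1$. A real $C$ is generically computable (respectively, generically $A$-computable) if there is a partial recursive (respectively, partial $A$-recursive) function $\varphi$ with values in $\{0,1\}$ whose domain has density $1$ and such that $\varphi(n)=1$ implies $n\in C$ and $\varphi(n)=0$ implies $n\notin C$. Two reals $A$ and $B$ form a minimal pair for generic computability if neither of them is recursive and every real that is both generically $A$-computable and generically $B$-computable is generically computable. Proposition. Let $A,B\subseteq\mathbb{N}$. If $A$ is $\Delta^0_2$ and $B$ is not $\Delta^0_2$, then $A$ and $B$ do not form a minimal pair for generic computability. (That is, if moreover $A$ is nonrecursive, then there is a real $C$ that is not generically computable but is both generically $A$-computable and generically $B$-computable.) -/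

import Mathlib

open Filter Topology

namespace GenericComputability

/-- A set of natural numbers ("real") is recursive if it is decidable by an algorithm. -/
def IsRecursive (A : Set ℕ) : Prop :=
  ComputablePred fun n : ℕ => n ∈ A

open Classical in
/-- The characteristic function of `A`, with values `0` and `1`. -/
noncomputable def charFun (A : Set ℕ) (n : ℕ) : ℕ :=
  if n ∈ A then 1 else 0

/-- The total characteristic function of `A`, as an oracle. -/
noncomputable def oracle (A : Set ℕ) : ℕ →. ℕ :=
  fun n => Part.some (charFun A n)

/-- `A` has density 1: `|A ∩ {0, …, n - 1}| / n → 1` as `n → ∞`. -/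
def HasDensityOne (A : Set ℕ) : Prop :=
  Tendsto (fun n : ℕ => ((A ∩ Set.Iio n).ncard : ℝ) / (n : ℝ)) atTop (𝓝 1)

/-- The partial function `φ` has density-1 domain, and each of its values is the correct bit
(`0` or `1`) of `A`. -/
def GenericallyDescribes (φ : ℕ →. ℕ) (A : Set ℕ) : Prop :=
  HasDensityOne φ.Dom ∧ ∀ n, ∀ v ∈ φ n, v = charFun A n

/-- `A` is generically computable. -/
def GenericallyComputable (A : Set ℕ) : Prop :=
  ∃ φ : ℕ →. ℕ, Nat.Partrec φ ∧ GenericallyDescribes φ A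

/-- `A` is generically `B`-computable: it is generically computable using `B` as an oracle. -/
def GenericallyComputableIn (B A : Set ℕ) : Prop :=
  ∃ φ : ℕ →. ℕ, Nat.RecursiveIn {oracle B} φ ∧ GenericallyDescribes φ A

/-- `A` and `B` form a minimal pair for generic computability: neither is recursive, and every
real that is both generically `A`-computable and generically `B`-computable is generically
computable. -/
def IsMinimalPair (A B : Set ℕ) : Prop :=
  ¬ IsRecursive A ∧ ¬ IsRecursive B ∧
    ∀ C : Set ℕ, GenericallyComputableIn A C → GenericallyComputableIn B C →
      GenericallyComputable C

/-- `A` is `Σ⁰₂`: `n ∈ A ↔ ∃ x, ∀ y, R n x y` for a recursive relation `R`. -/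
def IsSigma02 (A : Set ℕ) : Prop :=
  ∃ R : ℕ → ℕ → ℕ → Prop,
    ComputablePred (fun p : ℕ × ℕ × ℕ => R p.1 p.2.1 p.2.2) ∧
      ∀ n, n ∈ A ↔ ∃ x, ∀ y, R n x y

/-- `A` is `Π⁰₂`: `n ∈ A ↔ ∀ x, ∃ y, R n x y` for a recursive relation `R`. -/
def IsPi02 (A : Set ℕ) : Prop :=
  ∃ R : ℕ → ℕ → ℕ → Prop,
    ComputablePred (fun p : ℕ × ℕ × ℕ => R p.1 p.2.1 p.2.2) ∧
      ∀ n, n ∈ A ↔ ∀ x, ∃ y, R n x y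

/-- `A` is `Δ⁰₂`: it is both `Σ⁰₂` and `Π⁰₂`. -/
def IsDelta02 (A : Set ℕ) : Prop :=
  IsSigma02 A ∧ IsPi02 A

end GenericComputability

/-!
If `A` is computable from `B`, coding the bits of `A` into whole dyadic blocks gives a set that is
computable from both and whose generic descriptions compute `A`.

Otherwise we find a set `D` of density one that is r.e. in `A` and a set `E` of density one that is
r.e. in `B` such that every r.e. set of density one has infinitely many elements outside `D ∪ E`;
diagonalizing on the complement of `D ∪ E` gives the required set. The requirement of index `p`, for
an r.e. set `W` of density one, has to put an element of `W` outside `D ∪ E`. In a dyadic block it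
asks a question about an initial segment of `B`, with answers below `2 ^ p`. The set `E` omits the
residue class modulo `2 ^ p` of the true answer until `W` responds with its first element in the
block, and from then on at most that element. The set `D` omits the response if `A` permits it: at
no stage from the index `m` of the block on is a fixed computable approximation to `A` correct below
`m` before the response has arrived. If no late response fell into the true class, the responses
would refute all but fewer than `2 ^ p` strings of each length, so `B` would be recursive, being a
path of a co-r.e. tree of bounded width. If no response in the true class were permitted, `B` would
compute `A`. At most a fraction `2 ^ (-p)` of the numbers below any bound is omitted for the
requirement, and a set of density zero altogether, because a new question is asked only once `W` has
met another block.
-/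

namespace GenericComputability

open Nat.Partrec (Code)

/-! ### Computable predicates -/

section ComputablePred

variable {α β : Type*} [Primcodable α] [Primcodable β] {p q : α → Prop}

theorem computablePred_comp {r : β → Prop} (hr : ComputablePred r) {f : α → β}
    (hf : Computable f) : ComputablePred fun a => r (f a) := by
  obtain ⟨g, hg, rfl⟩ := ComputablePred.computable_iff.1 hr
  exact ComputablePred.computable_iff.2 ⟨_, hg.comp hf, rfl⟩

theorem computablePred_comp₃ {R : ℕ → ℕ → ℕ → Prop}
    (hR : ComputablePred fun x : ℕ × ℕ × ℕ => R x.1 x.2.1 x.2.2) {f g h : α → ℕ}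
    (hf : Computable f) (hg : Computable g) (hh : Computable h) :
    ComputablePred fun a => R (f a) (g a) (h a) :=
  computablePred_comp hR (hf.pair (hg.pair hh))

theorem computablePred_and (hp : ComputablePred p) (hq : ComputablePred q) :
    ComputablePred fun a => p a ∧ q a := by
  obtain ⟨f, hf, rfl⟩ := ComputablePred.computable_iff.1 hp
  obtain ⟨g, hg, rfl⟩ := ComputablePred.computable_iff.1 hq
  exact ComputablePred.computable_iff.2
    ⟨_, Primrec.and.to_comp.comp hf hg, by simp only [Bool.and_eq_true]⟩

theorem computablePred_imp (hp : ComputablePred p) (hq : ComputablePred q) :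
    ComputablePred fun a => p a → q a :=
  (computablePred_and hp hq.not).not.of_eq fun a => by tauto

theorem computablePred_iff (hp : ComputablePred p) (hq : ComputablePred q) :
    ComputablePred fun a => p a ↔ q a :=
  (computablePred_and (computablePred_imp hp hq) (computablePred_imp hq hp)).of_eq
    fun _ => iff_def.symm

theorem computablePred_eq {f g : α → β} (hf : Computable f) (hg : Computable g) :
    ComputablePred fun a => f a = g a :=
  computablePred_comp (r := fun x : β × β => x.1 = x.2) (PrimrecPred.computablePred Primrec.eq)
    (hf.pair hg)

theorem computablePred_le {f g : α → ℕ} (hf : Computable f) (hg : Computable g) :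
    ComputablePred fun a => f a ≤ g a :=
  computablePred_comp (r := fun x : ℕ × ℕ => x.1 ≤ x.2)
    (PrimrecPred.computablePred Primrec.nat_le) (hf.pair hg)

variable {f : α → ℕ} {R : α → ℕ → Prop}

theorem computablePred_forall_lt (hf : Computable f)
    (hR : ComputablePred fun x : α × ℕ => R x.1 x.2) :
    ComputablePred fun a => ∀ x < f a, R a x := by
  classical
  have hstep : Computable₂ fun (a : α) (x : ℕ × Bool) => x.2 && decide (R a x.1) :=
    Primrec.and.to_comp.comp (Computable.snd.comp Computable.snd)
      ((hR.decide).comp (Computable.fst.pair (Computable.fst.comp Computable.snd)))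
  refine ComputablePred.computable_iff.2
    ⟨_, Computable.nat_rec hf (Computable.const true) hstep, funext fun a => propext ?_⟩
  induction f a with
  | zero => simp
  | succ n ih =>
    rw [Nat.forall_lt_succ_right, ih]
    simp only [Bool.and_eq_true, decide_eq_true_eq]

theorem computablePred_exists_lt (hf : Computable f)
    (hR : ComputablePred fun x : α × ℕ => R x.1 x.2) :
    ComputablePred fun a => ∃ x < f a, R a x :=
  (computablePred_forall_lt (R := fun a x => ¬ R a x) hf hR.not).not.of_eq fun a => by
    push Not; rfl

theorem computablePred_isLeast (hR : ComputablePred fun x : α × ℕ => R x.1 x.2)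
    (hf : Computable f) : ComputablePred fun a => IsLeast {x | R a x} (f a) := by
  refine (computablePred_and (computablePred_comp hR (Computable.id.pair hf))
    (computablePred_forall_lt (R := fun a x => ¬ R a x) hf hR.not)).of_eq fun a => ?_
  refine and_congr_right fun _ => forall_congr' fun x => ?_
  exact ⟨fun h hx => not_lt.1 fun hlt => h hlt hx, fun h hlt hx => (h hx).not_gt hlt⟩

end ComputablePred

section Arithmetic

variable {α : Type*} [Primcodable α] {f g : α → ℕ}

theorem computable_nat_unpair_fst (hf : Computable f) : Computable fun a => (f a).unpair.1 :=
  Computable.fst.comp (Computable.unpair.comp hf)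

theorem computable_nat_unpair_snd (hf : Computable f) : Computable fun a => (f a).unpair.2 :=
  Computable.snd.comp (Computable.unpair.comp hf)

theorem computable_nat_mod (hf : Computable f) (hg : Computable g) :
    Computable fun a => f a % g a :=
  Primrec.nat_mod.to_comp.comp hf hg

theorem computable_two_pow (hf : Computable f) : Computable fun a => 2 ^ f a :=
  Primrec₂.to_comp (Primrec₂.unpaired'.1 Nat.Primrec.pow) |>.comp (Computable.const 2) hf

theorem computable_nat_log_two (hf : Computable f) : Computable fun a => Nat.log 2 (f a) := by
  have hpow : PrimrecRel fun n k : ℕ => 2 ^ k ≤ n :=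
    Primrec.nat_le.comp
      ((Primrec₂.unpaired'.1 Nat.Primrec.pow).comp (Primrec.const 2) Primrec.snd) Primrec.fst
  refine ((Primrec.nat_findGreatest Primrec.id hpow).to_comp.of_eq fun n => ?_).comp hf
  refine Nat.findGreatest_eq_iff.2 ⟨Nat.log_le_self 2 n, fun hlog => ?_, fun k hk _ => ?_⟩
  · exact Nat.pow_log_le_self 2 fun hn => hlog (by rw [hn, Nat.log_zero_right])
  · exact (Nat.lt_pow_of_log_lt one_lt_two hk).not_ge

theorem computablePred_testBit (hf : Computable f) (hg : Computable g) :
    ComputablePred fun a => (f a).testBit (g a) = true :=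
  (computablePred_eq (computable_nat_mod (Primrec.nat_div.to_comp.comp hf (computable_two_pow hg))
    (Computable.const 2)) (Computable.const 1)).of_eq fun a => by
      rw [Nat.testBit_eq_decide_div_mod_eq, decide_eq_true_eq]

end Arithmetic

theorem isRecursive_of_search {A : Set ℕ} {P Q : ℕ → ℕ → Prop}
    (hP : ComputablePred fun x : ℕ × ℕ => P x.1 x.2)
    (hQ : ComputablePred fun x : ℕ × ℕ => Q x.1 x.2) (hex : ∀ n, ∃ w, P n w)
    (hPQ : ∀ n w, P n w → (Q n w ↔ n ∈ A)) : IsRecursive A := by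
  classical
  exact (computablePred_comp hQ (Computable.id.pair (Computable.find hP hex))).of_eq
    fun n => hPQ n _ (Nat.find_spec (hex n))

/-! ### Oracle computations -/

/-- The initial segment of length `n` of the characteristic sequence of `X`, coded by the number
below `2 ^ n` whose binary digits it lists. -/
noncomputable def initSeg (X : Set ℕ) : ℕ → ℕ
  | 0 => 0
  | n + 1 => 2 ^ n * charFun X n + initSeg X n

section InitSeg

variable (X : Set ℕ) {m n i : ℕ}

theorem charFun_le_one (n : ℕ) : charFun X n ≤ 1 := by
  unfold charFun
  split_ifs <;> simp

theorem charFun_eq_one_iff : charFun X n = 1 ↔ n ∈ X := by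
  unfold charFun
  split_ifs with h <;> simp [h]

theorem initSeg_lt (n : ℕ) : initSeg X n < 2 ^ n := by
  induction n with
  | zero => simp [initSeg]
  | succ n ih =>
    have h : 2 ^ n * charFun X n ≤ 2 ^ n * 1 := Nat.mul_le_mul_left _ (charFun_le_one X n)
    rw [initSeg, pow_succ]
    omega

theorem initSeg_mod_two_pow (h : m ≤ n) : initSeg X n % 2 ^ m = initSeg X m := by
  induction n, h using Nat.le_induction with
  | base => exact Nat.mod_eq_of_lt (initSeg_lt X m)
  | succ n h ih =>
    obtain ⟨k, hk⟩ := (pow_dvd_pow 2 h).mul_right (charFun X n)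
    rw [initSeg, hk, Nat.mul_add_mod, ih]

theorem testBit_initSeg (h : i < n) : (initSeg X n).testBit i = true ↔ i ∈ X := by
  have hi : (initSeg X (i + 1)).testBit i = true ↔ i ∈ X := by
    rw [initSeg, Nat.testBit_two_pow_mul_add _ (initSeg_lt X i), if_neg (lt_irrefl i),
      Nat.sub_self, Nat.testBit_zero, decide_eq_true_eq, ← charFun_eq_one_iff]
    have := charFun_le_one X i
    omega
  rw [← hi, ← initSeg_mod_two_pow X h, Nat.testBit_mod_two_pow]
  simp

end InitSeg

section RecursiveIn

variable {O : Set (ℕ →. ℕ)} {f g : ℕ → ℕ}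

theorem recursiveIn_of_computable (hf : Computable f) :
    Nat.RecursiveIn O fun n => Part.some (f n) :=
  (Partrec.nat_iff.1 hf.partrec).recursiveIn

theorem recursiveIn_comp (hf : Nat.RecursiveIn O fun n => Part.some (f n))
    (hg : Nat.RecursiveIn O fun n => Part.some (g n)) :
    Nat.RecursiveIn O fun n => Part.some (f (g n)) :=
  (Nat.RecursiveIn.comp hf hg).of_eq fun _ => Part.bind_some _ _

theorem recursiveIn_pair (hf : Nat.RecursiveIn O fun n => Part.some (f n))
    (hg : Nat.RecursiveIn O fun n => Part.some (g n)) :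
    Nat.RecursiveIn O fun n => Part.some (Nat.pair (f n) (g n)) :=
  (Nat.RecursiveIn.pair hf hg).of_eq fun _ => by simp [Seq.seq]

theorem recursiveIn_nat_rec (a : ℕ) {h : ℕ → ℕ → ℕ}
    (hh : Nat.RecursiveIn O fun q => Part.some (h q.unpair.1 q.unpair.2)) :
    Nat.RecursiveIn O fun n => Part.some (Nat.rec a h n : ℕ) := by
  have hstep := recursiveIn_comp hh (recursiveIn_of_computable
    (computable_nat_unpair_snd Computable.id))
  refine (Nat.RecursiveIn.comp (.prec (recursiveIn_of_computable (Computable.const a)) hstep)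
    (recursiveIn_pair (recursiveIn_of_computable (Computable.const 0))
      (recursiveIn_of_computable Computable.id))).of_eq fun n => ?_
  simp only [Part.bind_eq_bind, Part.bind_some, Nat.unpair_pair, id]
  induction n with
  | zero => rfl
  | succ n ih => simp only [ih, Part.bind_some]

theorem recursiveIn_initSeg (X : Set ℕ) :
    Nat.RecursiveIn {oracle X} fun n => Part.some (initSeg X n) := by
  have hquery : Nat.RecursiveIn {oracle X} fun q => Part.some (charFun X q.unpair.1) :=
    recursiveIn_comp (.oracle (oracle X) rfl)
      (recursiveIn_of_computable (computable_nat_unpair_fst Computable.id))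
  have happend : Computable fun q : ℕ =>
      2 ^ q.unpair.2.unpair.1 * q.unpair.1 + q.unpair.2.unpair.2 :=
    Primrec.nat_add.to_comp.comp (Primrec.nat_mul.to_comp.comp
      (computable_two_pow (computable_nat_unpair_fst (computable_nat_unpair_snd Computable.id)))
      (computable_nat_unpair_fst Computable.id))
      (computable_nat_unpair_snd (computable_nat_unpair_snd Computable.id))
  have hstep : Nat.RecursiveIn {oracle X} fun q =>
      Part.some (2 ^ q.unpair.1 * charFun X q.unpair.1 + q.unpair.2) :=
    (recursiveIn_comp (recursiveIn_of_computable happend)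
      (recursiveIn_pair hquery (recursiveIn_of_computable Computable.id))).of_eq fun q => by
        simp only [Nat.unpair_pair, id]
  refine (recursiveIn_nat_rec (h := fun n σ => 2 ^ n * charFun X n + σ) 0 hstep).of_eq
    fun n => congrArg Part.some ?_
  induction n with
  | zero => rfl
  | succ n ih => rw [initSeg, ← ih]

theorem exists_recursiveIn_search (X : Set ℕ) {R : ℕ → ℕ → ℕ → Prop}
    (hR : ComputablePred fun x : ℕ × ℕ × ℕ => R x.1 x.2.1 x.2.2) {val : ℕ → ℕ → ℕ}
    (hval : Computable₂ val) :
    ∃ φ : ℕ →. ℕ, Nat.RecursiveIn {oracle X} φ ∧ φ.Dom = {n | ∃ s, R n s (initSeg X s)} ∧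
      ∀ n, ∀ v ∈ φ n, ∃ s, R n s (initSeg X s) ∧ v = val n s := by
  classical
  have htest : Computable fun q : ℕ =>
      if R q.unpair.1.unpair.1 q.unpair.1.unpair.2 q.unpair.2 then 0 else 1 :=
    ComputablePred.ite (Computable.const 0) (Computable.const 1) (computablePred_comp₃ hR
      (computable_nat_unpair_fst (computable_nat_unpair_fst Computable.id))
      (computable_nat_unpair_snd (computable_nat_unpair_fst Computable.id))
      (computable_nat_unpair_snd Computable.id))
  have hseg : Nat.RecursiveIn {oracle X} fun q => Part.some (Nat.pair q (initSeg X q.unpair.2)) :=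
    recursiveIn_pair (recursiveIn_of_computable Computable.id) (recursiveIn_comp
      (recursiveIn_initSeg X) (recursiveIn_of_computable (computable_nat_unpair_snd Computable.id)))
  let search : ℕ →. ℕ := fun n => Nat.rfind (PFun.lift fun s => decide (R n s (initSeg X s)))
  have hsearch : Nat.RecursiveIn {oracle X} search :=
    (Nat.RecursiveIn.rfind (recursiveIn_comp (recursiveIn_of_computable htest) hseg)).of_eq
      fun n => by
        simp only [Nat.unpair_pair, Part.map_eq_map, Part.map_some, ite_eq_left_iff, one_ne_zero,
          imp_false, not_not]
        rfl
  have hmem (n s : ℕ) (hs : s ∈ search n) : R n s (initSeg X s) := by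
    simpa using Nat.rfind_spec hs
  have hdom (n : ℕ) : (search n).Dom ↔ ∃ s, R n s (initSeg X s) := by
    simp [search]
  have hval' : Nat.RecursiveIn {oracle X} fun q => Part.some (val q.unpair.1 q.unpair.2) :=
    recursiveIn_of_computable (hval.comp (computable_nat_unpair_fst Computable.id)
      (computable_nat_unpair_snd Computable.id))
  refine ⟨fun n => (search n).map (val n),
    (Nat.RecursiveIn.comp hval' (.pair (recursiveIn_of_computable Computable.id) hsearch)).of_eq
      fun n => ?_, Set.ext hdom, fun n v hv => ?_⟩
  · simp only [Seq.seq, id, Part.map_eq_map, Part.map_some, Part.bind_eq_bind, Part.bind_some,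
      Part.bind_map, Nat.unpair_pair]
    exact Part.bind_some_eq_map (val n) (search n)
  · obtain ⟨s, hs, rfl⟩ := (Part.mem_map_iff _).1 hv
    exact ⟨s, hmem n s hs, rfl⟩

end RecursiveIn

/-! ### Limit approximations -/

section Limit

theorem eventually_forall_exists_lt {P : ℕ → ℕ → Prop} {k : ℕ} (h : ∀ x < k, ∃ y, P x y) :
    ∀ᶠ s in atTop, ∀ x < k, ∃ y < s, P x y := by
  refine (eventually_all_finite (Set.finite_Iio k)).2 fun x hx => ?_
  obtain ⟨y, hy⟩ := h x hx
  filter_upwards [eventually_gt_atTop y] with s hs using ⟨y, hs, hy⟩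

variable {A : Set ℕ} {a : ℕ → ℕ → Prop}

theorem IsDelta02.exists_approx (hA : IsDelta02 A) :
    ∃ a : ℕ → ℕ → Prop, (ComputablePred fun q : ℕ × ℕ => a q.1 q.2) ∧
      ∀ n, ∀ᶠ s in atTop, (a s n ↔ n ∈ A) := by
  obtain ⟨⟨R₁, hR₁, hA₁⟩, R₂, hR₂, hA₂⟩ := hA
  refine ⟨fun s n => ∃ x < s, (∀ y < s, R₁ n x y) ∧ ∀ x' < x, ∃ y < s, R₂ n x' y, ?_, fun n => ?_⟩
  · refine computablePred_exists_lt (α := ℕ × ℕ)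
      (R := fun q x => (∀ y < q.1, R₁ q.2 x y) ∧ ∀ x' < x, ∃ y < q.1, R₂ q.2 x' y)
      Computable.fst (computablePred_and ?_ ?_)
    · exact computablePred_forall_lt (R := fun q : (ℕ × ℕ) × ℕ => R₁ q.1.2 q.2)
        (Computable.fst.comp .fst)
        (computablePred_comp₃ hR₁ (Computable.snd.comp (Computable.fst.comp .fst))
          (Computable.snd.comp .fst) .snd)
    · refine computablePred_forall_lt
        (R := fun (q : (ℕ × ℕ) × ℕ) x' => ∃ y < q.1.1, R₂ q.1.2 x' y) .snd ?_
      exact computablePred_exists_lt (R := fun q : ((ℕ × ℕ) × ℕ) × ℕ => R₂ q.1.1.2 q.2)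
        (Computable.fst.comp (Computable.fst.comp .fst))
        (computablePred_comp₃ hR₂
          (Computable.snd.comp (Computable.fst.comp (Computable.fst.comp .fst)))
          (Computable.snd.comp .fst) .snd)
  by_cases hn : n ∈ A
  · obtain ⟨x, hx⟩ := (hA₁ n).1 hn
    filter_upwards [eventually_forall_exists_lt fun x' (_ : x' < x) => (hA₂ n).1 hn x',
      eventually_gt_atTop x] with s hs hxs
    exact iff_of_true ⟨x, hxs, fun y _ => hx y, hs⟩ hn
  · obtain ⟨x₀, hx₀⟩ : ∃ x, ∀ y, ¬ R₂ n x y := by simpa using mt (hA₂ n).2 hn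
    have hR₁n : ∀ x, ∃ y, ¬ R₁ n x y := by simpa using mt (hA₁ n).2 hn
    filter_upwards [eventually_forall_exists_lt fun x (_ : x < x₀ + 1) => hR₁n x] with s hs
    refine iff_of_false ?_ hn
    rintro ⟨x, -, hx, hx'⟩
    rcases Nat.lt_or_ge x (x₀ + 1) with hlt | hge
    · obtain ⟨y, hys, hy⟩ := hs x hlt
      exact hy (hx y hys)
    · obtain ⟨y, -, hy⟩ := hx' x₀ hge
      exact hx₀ y hy

theorem eventually_forall_lt_iff_mem (ha : ∀ n, ∀ᶠ s in atTop, (a s n ↔ n ∈ A)) (m : ℕ) :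
    ∀ᶠ s in atTop, ∀ i < m, (a s i ↔ i ∈ A) :=
  (eventually_all_finite (Set.finite_Iio m)).2 fun i _ => ha i

end Limit

/-! ### Density -/

/-- Asymptotic density `0`, the smallness notion dual to `HasDensityOne`. -/
def HasDensityZero (S : Set ℕ) : Prop :=
  Tendsto (fun n : ℕ => ((S ∩ Set.Iio n).ncard : ℝ) / n) atTop (𝓝 0)

section Density

variable {S : Set ℕ}

theorem ncard_inter_Iio_le (S : Set ℕ) (n : ℕ) : (S ∩ Set.Iio n).ncard ≤ n := by
  simpa using Set.ncard_le_ncard (Set.inter_subset_right : S ∩ Set.Iio n ⊆ Set.Iio n)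
    (Set.finite_Iio n)

theorem hasDensityOne_iff_compl : HasDensityOne S ↔ HasDensityZero Sᶜ := by
  have hcard (n : ℕ) : (S ∩ Set.Iio n).ncard + (Sᶜ ∩ Set.Iio n).ncard = n := by
    simpa [Set.inter_comm, Set.sdiff_eq] using
      Set.ncard_inter_add_ncard_sdiff_eq_ncard (Set.Iio n) S (Set.finite_Iio n)
  have hratio : ∀ᶠ n : ℕ in atTop, ((S ∩ Set.Iio n).ncard : ℝ) / n =
      1 - ((Sᶜ ∩ Set.Iio n).ncard : ℝ) / n := by
    filter_upwards [eventually_gt_atTop 0] with n hn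
    have hn' : (n : ℝ) ≠ 0 := by exact_mod_cast hn.ne'
    have hcard' : ((S ∩ Set.Iio n).ncard : ℝ) + (Sᶜ ∩ Set.Iio n).ncard = n :=
      mod_cast hcard n
    rw [eq_sub_iff_add_eq, ← add_div, hcard', div_self hn']
  rw [HasDensityOne, tendsto_congr' hratio]
  constructor
  · intro h
    simpa [HasDensityZero] using h.const_sub 1
  · intro h
    simpa using Tendsto.const_sub 1 h

theorem hasDensityZero_of_finite (hS : S.Finite) : HasDensityZero S := by
  refine squeeze_zero (fun n => by positivity) (fun n => ?_)
    (tendsto_const_div_atTop_nhds_zero_nat (S.ncard : ℝ))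
  gcongr
  exact Set.inter_subset_left

theorem tendsto_log_two_add_one_div :
    Tendsto (fun n : ℕ => ((Nat.log 2 n + 1 : ℕ) : ℝ) / n) atTop (𝓝 0) := by
  have hlog : Tendsto (fun n : ℕ => Real.log n / n) atTop (𝓝 0) :=
    Real.isLittleO_log_id_atTop.tendsto_div_nhds_zero.comp tendsto_natCast_atTop_atTop
  have hlim : Tendsto (fun n : ℕ => Real.log n / n / Real.log 2 + 1 / n) atTop (𝓝 0) := by
    simpa using (hlog.div_const (Real.log 2)).add (tendsto_const_div_atTop_nhds_zero_nat (1 : ℝ))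
  refine squeeze_zero (fun n => by positivity) (fun n => ?_) hlim
  have hle : ((Nat.log 2 n : ℕ) : ℝ) ≤ Real.log n / Real.log 2 := by
    simpa [Real.logb] using Real.natLog_le_logb n 2
  calc ((Nat.log 2 n + 1 : ℕ) : ℝ) / n ≤ (Real.log n / Real.log 2 + 1) / n := by
        push_cast
        gcongr
    _ = Real.log n / n / Real.log 2 + 1 / n := by ring

theorem hasDensityZero_of_injOn_log (hS : S.InjOn (Nat.log 2)) : HasDensityZero S := by
  refine squeeze_zero (fun n => by positivity) (fun n => ?_) tendsto_log_two_add_one_div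
  gcongr
  have hmaps : Set.MapsTo (Nat.log 2) (S ∩ Set.Iio n) (Set.Iio (Nat.log 2 n + 1)) :=
    fun x hx => Nat.lt_succ_of_le (Nat.log_mono_right hx.2.le)
  simpa using Set.ncard_le_ncard_of_injOn _ hmaps (hS.mono Set.inter_subset_left)
    (Set.finite_Iio _)

/-- The elements of a dyadic block that share a residue modulo `2 ^ p` are `2 ^ p` apart, so
division by `2 ^ p` is injective on `S`. -/
theorem ncard_inter_Iio_mul_two_pow_le {p : ℕ} (hp : ∀ x ∈ S, p ≤ Nat.log 2 x)
    (hmod : ∀ x ∈ S, ∀ y ∈ S, Nat.log 2 x = Nat.log 2 y → x % 2 ^ p = y % 2 ^ p) (n : ℕ) :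
    (S ∩ Set.Iio n).ncard * 2 ^ p ≤ n := by
  rcases p.eq_zero_or_pos with rfl | hpos
  · simpa using ncard_inter_Iio_le S n
  have hmaps : Set.MapsTo (· / 2 ^ p) (S ∩ Set.Iio n) (Set.Icc 1 (n / 2 ^ p)) := by
    rintro x ⟨hx, hxn⟩
    have hx0 : x ≠ 0 := fun h => by
      have := hp x hx
      rw [h, Nat.log_zero_right] at this
      omega
    exact ⟨Nat.div_pos (Nat.pow_le_of_le_log hx0 (hp x hx)) (by positivity),
      Nat.div_le_div_right (le_of_lt hxn)⟩
  have hinj : (S ∩ Set.Iio n).InjOn (· / 2 ^ p) := by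
    rintro x ⟨hx, -⟩ y ⟨hy, -⟩ (hxy : x / 2 ^ p = y / 2 ^ p)
    have hlog : Nat.log 2 x - p = Nat.log 2 y - p := by
      rw [← Nat.log_div_base_pow, hxy, Nat.log_div_base_pow]
    have hlog' : Nat.log 2 x = Nat.log 2 y := by
      have := hp x hx
      have := hp y hy
      omega
    rw [← Nat.div_add_mod x (2 ^ p), hxy, hmod x hx y hy hlog', Nat.div_add_mod]
  have hcard := Set.ncard_le_ncard_of_injOn _ hmaps hinj (Set.finite_Icc _ _)
  rw [← Finset.coe_Icc, Set.ncard_coe_finset, Nat.card_Icc, Nat.add_sub_cancel] at hcard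
  exact (Nat.le_div_iff_mul_le (by positivity)).1 hcard

theorem hasDensityZero_iUnion {O : ℕ → Set ℕ} (hzero : ∀ p, HasDensityZero (O p))
    (hbound : ∀ p n, (O p ∩ Set.Iio n).ncard * 2 ^ p ≤ n) : HasDensityZero (⋃ p, O p) := by
  have hratio (p n : ℕ) : ((O p ∩ Set.Iio n).ncard : ℝ) / n ≤ (1 / 2) ^ p := by
    have hle : ((O p ∩ Set.Iio n).ncard : ℝ) * 2 ^ p ≤ n := mod_cast hbound p n
    refine div_le_of_le_mul₀ (by positivity) (by positivity) ?_
    rwa [one_div, inv_pow, mul_comm, ← div_eq_mul_inv, le_div_iff₀ (by positivity)]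
  have hlim : Tendsto (fun n : ℕ => ∑' p, ((O p ∩ Set.Iio n).ncard : ℝ) / n) atTop (𝓝 0) := by
    simpa using tendsto_tsum_of_dominated_convergence (𝓕 := atTop) summable_geometric_two hzero
      (Eventually.of_forall fun n p => by
        rw [Real.norm_of_nonneg (by positivity)]
        exact hratio p n)
  refine squeeze_zero (fun n => by positivity) (fun n => ?_) hlim
  have hsub : (⋃ p, O p) ∩ Set.Iio n ⊆ ⋃ p ∈ Finset.range n, (O p ∩ Set.Iio n) := by
    rintro x ⟨hx, hxn⟩
    obtain ⟨p, hp⟩ := Set.mem_iUnion.1 hx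
    refine Set.mem_iUnion₂.2 ⟨p, Finset.mem_range.2 ?_, hp, hxn⟩
    have hpos : 0 < (O p ∩ Set.Iio n).ncard :=
      (Set.ncard_pos ((Set.finite_Iio n).inter_of_right _)).2 ⟨x, hp, hxn⟩
    exact (Nat.lt_two_pow_self).trans_le ((Nat.le_mul_of_pos_left _ hpos).trans (hbound p n))
  have hcard : ((⋃ p, O p) ∩ Set.Iio n).ncard ≤ ∑ p ∈ Finset.range n, (O p ∩ Set.Iio n).ncard :=
    (Set.ncard_le_ncard hsub (Set.Finite.biUnion (Finset.finite_toSet _)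
      fun _ _ => (Set.finite_Iio n).inter_of_right _)).trans (Finset.set_ncard_biUnion_le _ _)
  calc (((⋃ p, O p) ∩ Set.Iio n).ncard : ℝ) / n
      ≤ (∑ p ∈ Finset.range n, ((O p ∩ Set.Iio n).ncard : ℝ)) / n := by
        gcongr
        exact_mod_cast hcard
    _ = ∑ p ∈ Finset.range n, ((O p ∩ Set.Iio n).ncard : ℝ) / n := Finset.sum_div _ _ _
    _ ≤ ∑' p, ((O p ∩ Set.Iio n).ncard : ℝ) / n :=
        Summable.sum_le_tsum _ (fun p _ => by positivity) <|
          Summable.of_nonneg_of_le (fun p => by positivity) (fun p => hratio p n)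
            summable_geometric_two

theorem HasDensityOne.eventually_exists_log_eq (hS : HasDensityOne S) :
    ∀ᶠ m in atTop, ∃ x ∈ S, Nat.log 2 x = m := by
  have hpow : Tendsto (fun m : ℕ => 2 ^ (m + 1)) atTop atTop :=
    (tendsto_pow_atTop_atTop_of_one_lt one_lt_two).comp (tendsto_add_atTop_nat 1)
  have hhalf : ∀ᶠ n : ℕ in atTop, ((Sᶜ ∩ Set.Iio n).ncard : ℝ) / n < 1 / 2 :=
    (hasDensityOne_iff_compl.1 hS).eventually_lt_const (by norm_num)
  filter_upwards [hpow.eventually hhalf] with m hm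
  by_contra! hmiss
  have hsub : Set.Ico (2 ^ m) (2 ^ (m + 1)) ⊆ Sᶜ ∩ Set.Iio (2 ^ (m + 1)) := fun x hx =>
    ⟨fun hxS => hmiss x hxS (Nat.log_eq_of_pow_le_of_lt_pow hx.1 hx.2), hx.2⟩
  have hcard := Set.ncard_le_ncard hsub ((Set.finite_Iio _).inter_of_right _)
  rw [← Finset.coe_Ico, Set.ncard_coe_finset, Nat.card_Ico, pow_succ, mul_two,
    Nat.add_sub_cancel, ← mul_two, ← pow_succ] at hcard
  rw [div_lt_iff₀ (by positivity)] at hm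
  have hcard' : (2 : ℝ) ^ m ≤ (Sᶜ ∩ Set.Iio (2 ^ (m + 1))).ncard := mod_cast hcard
  rw [Nat.cast_pow, Nat.cast_ofNat] at hm
  linarith [pow_succ (2 : ℝ) m]

end Density

/-! ### Trees of bounded width -/

section BoundedWidth

variable {X : Set ℕ} {M : ℕ}

theorem exists_isolating_initSeg {T : ℕ → ℕ → Prop}
    (hM : ∀ k, {σ | σ < 2 ^ k ∧ T k σ}.ncard ≤ M) :
    ∃ c, ∀ n, ∃ k, c ≤ k ∧ n < k ∧
      ∀ σ < 2 ^ k, T k σ → σ % 2 ^ c = initSeg X c → (σ.testBit n = true ↔ n ∈ X) := by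
  classical
  let ext (c k : ℕ) : Set ℕ := {σ | (σ < 2 ^ k ∧ T k σ) ∧ σ % 2 ^ c = initSeg X c}
  have hfin (k : ℕ) : {σ | σ < 2 ^ k ∧ T k σ}.Finite :=
    (Set.finite_Iio (2 ^ k)).subset fun σ hσ => hσ.1
  have hex : ∃ r c, ∃ᶠ k in atTop, (ext c k).ncard ≤ r :=
    ⟨M, 0, Frequently.of_forall fun k =>
      (Set.ncard_le_ncard (fun σ hσ => hσ.1) (hfin k)).trans (hM k)⟩
  obtain ⟨c, hc⟩ := Nat.find_spec hex
  refine ⟨c, fun n => ?_⟩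
  by_contra! hcon
  let d := max c (n + 1)
  have hlt : ∀ k ≥ d, (ext d k).ncard < (ext c k).ncard := by
    intro k hk
    obtain ⟨σ, hσ, hT, hσc, hbit⟩ := hcon k (by omega) (by omega)
    refine Set.ncard_lt_ncard ⟨?_, fun hsub => ?_⟩ ((hfin k).subset fun σ hσ => hσ.1)
    · rintro ρ ⟨hρ, hρd⟩
      refine ⟨hρ, ?_⟩
      rw [← initSeg_mod_two_pow X (le_max_left c (n + 1)), ← hρd,
        Nat.mod_mod_of_dvd _ (pow_dvd_pow 2 (le_max_left c (n + 1)))]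
    · have hσd : σ % 2 ^ d = initSeg X d := (hsub ⟨⟨hσ, hT⟩, hσc⟩).2
      have hn : n < d := by omega
      have hbit' : σ.testBit n = true ↔ n ∈ X := by
        rw [← testBit_initSeg X hn, ← hσd, Nat.testBit_mod_two_pow]
        simp [hn]
      tauto
  have hfreq : ∃ᶠ k in atTop, (ext d k).ncard < Nat.find hex :=
    (hc.and_eventually (eventually_ge_atTop d)).mono fun k hk => (hlt k hk.2).trans_le hk.1
  obtain ⟨k, hk⟩ := hfreq.exists
  exact Nat.find_min hex (Nat.sub_one_lt_of_lt hk)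
    ⟨d, hfreq.mono fun _ => Nat.le_sub_one_of_lt⟩

/-- By stage `z`, all strings of length `k` that extend the string `τ` of length `c` and whose
bit at `n` differs from `b` have been found to satisfy `R`. -/
def ForcesBit (R : ℕ → ℕ → ℕ → Prop) (c τ n k z b : ℕ) : Prop :=
  c ≤ k ∧ n < k ∧ ∀ σ < 2 ^ k, σ % 2 ^ c = τ → (σ.testBit n = true ↔ b = 1) ∨ ∃ y < z, R k σ y

variable {R : ℕ → ℕ → ℕ → Prop}

theorem computablePred_forcesBit (hR : ComputablePred fun x : ℕ × ℕ × ℕ => R x.1 x.2.1 x.2.2)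
    (c τ : ℕ) {α : Type*} [Primcodable α] {n k z b : α → ℕ} (hn : Computable n)
    (hk : Computable k) (hz : Computable z) (hb : Computable b) :
    ComputablePred fun q => ForcesBit R c τ (n q) (k q) (z q) (b q) := by
  refine computablePred_and (computablePred_le (.const c) hk) <| computablePred_and
    (computablePred_le (Computable.succ.comp hn) hk) <| computablePred_forall_lt
    (R := fun q σ => σ % 2 ^ c = τ →
      (σ.testBit (n q) = true ↔ b q = 1) ∨ ∃ y < z q, R (k q) σ y)
    (computable_two_pow hk) <| computablePred_imp
    (computablePred_eq (computable_nat_mod .snd (.const _)) (.const τ)) ?_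
  have hbit : ComputablePred fun q : α × ℕ => q.2.testBit (n q.1) = true ↔ b q.1 = 1 :=
    computablePred_iff (computablePred_testBit .snd (hn.comp .fst))
      (computablePred_eq (hb.comp .fst) (.const 1))
  have hR' : ComputablePred fun q : α × ℕ => ∃ y < z q.1, R (k q.1) q.2 y :=
    computablePred_exists_lt (R := fun q : α × ℕ => R (k q.1) q.2) (hz.comp .fst)
      (computablePred_comp₃ hR (hk.comp (Computable.fst.comp .fst)) (Computable.snd.comp .fst) .snd)
  exact (computablePred_imp hbit.not hR').of_eq fun q => or_iff_not_imp_left.symm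

/-- The unrefuted strings form a co-r.e. tree of bounded width, in which every path is isolated
and hence recursive. -/
theorem isRecursive_of_refuted (hR : ComputablePred fun x : ℕ × ℕ × ℕ => R x.1 x.2.1 x.2.2)
    (hX : ∀ k y, ¬ R k (initSeg X k) y)
    (hM : ∀ k, {σ | σ < 2 ^ k ∧ ∀ y, ¬ R k σ y}.ncard ≤ M) : IsRecursive X := by
  obtain ⟨c, hc⟩ := exists_isolating_initSeg (X := X) hM
  have hsnd : Computable fun q : ℕ × ℕ => q.2.unpair.2 := computable_nat_unpair_snd .snd
  refine isRecursive_of_search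
    (P := fun n w => ForcesBit R c (initSeg X c) n w.unpair.1 w.unpair.2.unpair.1
      w.unpair.2.unpair.2) (Q := fun _ w => w.unpair.2.unpair.2 = 1)
    (computablePred_forcesBit hR c _ .fst (computable_nat_unpair_fst .snd)
      (computable_nat_unpair_fst hsnd) (computable_nat_unpair_snd hsnd))
    (computablePred_eq (computable_nat_unpair_snd hsnd) (.const 1)) (fun n => ?_)
    fun n w ⟨hck, hnk, hw⟩ => ?_
  · obtain ⟨k, hck, hnk, hk⟩ := hc n
    let S : ℕ → ℕ → Prop := fun σ y =>
      (σ % 2 ^ c = initSeg X c → (σ.testBit n = true ↔ n ∈ X)) ∨ R k σ y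
    have hS : ∀ σ < 2 ^ k, ∃ y, S σ y := fun σ hσ => by
      by_cases hσR : ∃ y, R k σ y
      · exact hσR.imp fun y hy => Or.inr hy
      · exact ⟨0, Or.inl (hk σ hσ (not_exists.1 hσR))⟩
    obtain ⟨z, hz⟩ := (eventually_forall_exists_lt hS).exists
    refine ⟨Nat.pair k (Nat.pair z (charFun X n)), ?_⟩
    simp only [Nat.unpair_pair]
    refine ⟨hck, hnk, fun σ hσ hσc => ?_⟩
    obtain ⟨y, hyz, hy⟩ := hz σ hσ
    exact hy.imp (fun h => (h hσc).trans (charFun_eq_one_iff X).symm) fun h => ⟨y, hyz, h⟩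
  · rcases hw _ (initSeg_lt X _) (initSeg_mod_two_pow X hck) with hbit | ⟨y, -, hy⟩
    · rw [← hbit, testBit_initSeg X hnk]
    · exact absurd hy (hX _ y)

end BoundedWidth

/-! ### Permitting -/

section Permitting

variable {A B : Set ℕ} {a : ℕ → ℕ → Prop}

/-- At every stage `t ≥ m` at which the approximation `a` to `A` is correct below `m`, the
event `w` has already happened. -/
def Permitted (a : ℕ → ℕ → Prop) (A : Set ℕ) (m w : ℕ) : Prop :=
  ∀ t ≥ m, (∀ i < m, (a t i ↔ i ∈ A)) → w ≤ t

/-- The approximation `a` does not change at `n` from stage `m` until stage `w`. -/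
def IsSteady (a : ℕ → ℕ → Prop) (n m w : ℕ) : Prop :=
  ∀ t < w, m ≤ t → (a t n ↔ a m n)

theorem computablePred_isSteady (ha : ComputablePred fun q : ℕ × ℕ => a q.1 q.2) :
    ComputablePred fun q : ℕ × ℕ × ℕ => IsSteady a q.1 q.2.1 q.2.2 :=
  computablePred_forall_lt (R := fun q t => q.2.1 ≤ t → (a t q.1 ↔ a q.2.1 q.1))
    (Computable.snd.comp .snd) <| computablePred_imp
      (computablePred_le (Computable.fst.comp (Computable.snd.comp .fst)) .snd) <|
      computablePred_iff (computablePred_comp ha (Computable.snd.pair (Computable.fst.comp .fst)))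
        (computablePred_comp ha ((Computable.fst.comp (Computable.snd.comp .fst)).pair
          (Computable.fst.comp .fst)))

/-- If no event were permitted then, between `m` and the event `w`, the approximation would be
correct at some stage, so a value that it keeps throughout that interval would be correct. -/
theorem recursiveIn_oracle_of_not_permitted (ha : ComputablePred fun q : ℕ × ℕ => a q.1 q.2)
    (haA : ∀ n, ∀ᶠ s in atTop, (a s n ↔ n ∈ A)) {R : ℕ → ℕ → ℕ → Prop}
    (hR : ComputablePred fun x : ℕ × ℕ × ℕ => R x.1 x.2.1 x.2.2)
    (hRB : ∀ N, ∃ m ≥ N, ∃ w, R m w (initSeg B m))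
    (hnot : ∀ m w, R m w (initSeg B m) → ¬ Permitted a A m w) :
    Nat.RecursiveIn {oracle B} (oracle A) := by
  classical
  have hfst : Computable fun q : ℕ × ℕ × ℕ => q.2.1.unpair.1 :=
    computable_nat_unpair_fst (Computable.fst.comp .snd)
  have hsnd : Computable fun q : ℕ × ℕ × ℕ => q.2.1.unpair.2 :=
    computable_nat_unpair_snd (Computable.fst.comp .snd)
  have hval : Computable₂ fun n s : ℕ => bif decide (a s.unpair.1 n) then 1 else 0 :=
    (computablePred_comp ha ((computable_nat_unpair_fst Computable.snd).pair .fst)).decide.cond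
      (.const 1) (.const 0)
  obtain ⟨φ, hφ, hdom, hφA⟩ := exists_recursiveIn_search B
    (R := fun n s σ => n < s.unpair.1 ∧ R s.unpair.1 s.unpair.2 (σ % 2 ^ s.unpair.1) ∧
      IsSteady a n s.unpair.1 s.unpair.2)
    (computablePred_and (computablePred_le (Computable.succ.comp .fst) hfst) <|
      computablePred_and (computablePred_comp₃ hR hfst hsnd
        (computable_nat_mod (Computable.snd.comp .snd) (computable_two_pow hfst)))
        (computablePred_comp₃ (computablePred_isSteady ha) .fst hfst hsnd)) hval
  refine hφ.of_eq fun n => ?_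
  obtain ⟨v, hv⟩ : ∃ v, v ∈ φ n := by
    refine Part.dom_iff_mem.1 (?_ : n ∈ φ.Dom)
    rw [hdom]
    obtain ⟨N, hN⟩ := eventually_atTop.1 (haA n)
    obtain ⟨m, hm, w, hw⟩ := hRB (max N (n + 1))
    refine ⟨Nat.pair m w, ?_⟩
    simp only [Nat.unpair_pair, initSeg_mod_two_pow B (Nat.left_le_pair m w)]
    exact ⟨by omega, hw, fun t _ ht => (hN t (by omega)).trans (hN m (by omega)).symm⟩
  obtain ⟨s, ⟨hn, hs, hsteady⟩, rfl⟩ := hφA n v hv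
  rw [initSeg_mod_two_pow B (Nat.unpair_left_le s)] at hs
  obtain ⟨t, ht, hcorrect, hlt⟩ : ∃ t ≥ s.unpair.1, (∀ i < s.unpair.1, (a t i ↔ i ∈ A)) ∧
      t < s.unpair.2 := by simpa [Permitted] using hnot _ _ hs
  rw [Part.eq_some_iff.2 hv, oracle, charFun]
  simp only [Bool.cond_decide, ← hsteady t hlt ht, hcorrect n hn]

end Permitting

/-! ### Queries and responses -/

section Game

variable {W : ℕ → ℕ → Prop} {p i k m w w' : ℕ} {σ : ℕ}

/-- The pair `w = ⟨s, x⟩` witnesses that the set enumerated by `W` meets the `m`-th dyadic block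
`{x | Nat.log 2 x = m}`: by stage `s`, the element `x` of that block has been enumerated. -/
def Meets (W : ℕ → ℕ → Prop) (m w : ℕ) : Prop :=
  Nat.log 2 w.unpair.2 = m ∧ W w.unpair.1 w.unpair.2

/-- `w` is the least witness that `W` meets the block `m`: the opponent's move in that block. -/
def IsResponse (W : ℕ → ℕ → Prop) (m w : ℕ) : Prop :=
  IsLeast {w | Meets W m w} w

/-- The requirement of index `p` poses a query in the block `m = ⟨i, t⟩`, which happens when `t`
is the first stage by which `W` is seen to meet the `i` blocks from the `p`-th one on. -/
def IsActive (W : ℕ → ℕ → Prop) (p m : ℕ) : Prop :=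
  p ≤ m ∧ IsLeast {t | ∀ k < m.unpair.1, ∃ w < t, Meets W (p + k) w} m.unpair.2

/-- Blocks `m = ⟨⟨⟨k, L⟩, r⟩, t⟩` pose queries about the first `k` bits of an oracle. -/
def queryLength (m : ℕ) : ℕ :=
  m.unpair.1.unpair.1.unpair.1

/-- The position of the first `queryLength m` bits of `σ` in the list `L` of strings that is
coded by the block `m = ⟨⟨⟨k, L⟩, r⟩, t⟩`. -/
def querySlot (m σ : ℕ) : ℕ :=
  ((Encodable.decode m.unpair.1.unpair.1.unpair.2 : Option (List ℕ)).getD []).idxOf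
    (σ % 2 ^ queryLength m)

theorem queryLength_le (m : ℕ) : queryLength m ≤ m :=
  (Nat.unpair_left_le _).trans ((Nat.unpair_left_le _).trans (Nat.unpair_left_le m))

theorem querySlot_mod (h : queryLength m ≤ k) : querySlot m (σ % 2 ^ k) = querySlot m σ := by
  rw [querySlot, querySlot, Nat.mod_mod_of_dvd _ (pow_dvd_pow 2 h)]

theorem IsResponse.log_eq (h : IsResponse W m w) : Nat.log 2 w.unpair.2 = m :=
  h.1.1

theorem exists_isResponse (h : ∃ w, Meets W m w) : ∃ w, IsResponse W m w := by
  classical exact ⟨Nat.find h, Nat.isLeast_find h⟩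

theorem exists_isActive (hW : ∀ k ≥ p, ∃ w, Meets W k w) (hi : p ≤ i) :
    ∃ t, IsActive W p (Nat.pair i t) := by
  classical
  have hstage : ∃ t, ∀ k < i, ∃ w < t, Meets W (p + k) w :=
    (eventually_forall_exists_lt fun k _ => hW (p + k) (Nat.le_add_right p k)).exists
  refine ⟨Nat.find hstage, hi.trans (Nat.left_le_pair _ _), ?_⟩
  simpa only [Nat.unpair_pair] using Nat.isLeast_find hstage

theorem finite_isActive (hW : ¬ ∃ w, Meets W (p + k) w) : {m | IsActive W p m}.Finite := by
  have hmaps : Set.MapsTo (fun m : ℕ => m.unpair.1) {m | IsActive W p m} (Set.Iic k) :=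
    fun m hm => not_lt.1 fun hlt => hW ((hm.2.1 k hlt).imp fun _ h => h.2)
  refine Set.Finite.of_injOn hmaps (fun m hm m' hm' hmm' => ?_) (Set.finite_Iic k)
  have ht := hm.2
  simp only [show m.unpair.1 = m'.unpair.1 from hmm'] at ht
  rw [← Nat.pair_unpair m, ← Nat.pair_unpair m', hmm', ht.unique hm'.2]

/-- Querying the list `l` in a block of index at least `N`, the opponent refutes the string whose
position in `l` is the residue of the response. -/
theorem exists_refuted (hW : ∀ k ≥ p, ∃ w, Meets W k w) {l : List ℕ} (hl : l.Nodup)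
    (hlen : l.length = 2 ^ p) (hlk : ∀ σ ∈ l, σ < 2 ^ k) (N : ℕ) :
    ∃ σ ∈ l, ∃ m ≥ N, ∃ w, IsActive W p m ∧ queryLength m = k ∧ IsResponse W m w ∧
      querySlot m σ = w.unpair.2 % 2 ^ p := by
  let i := Nat.pair (Nat.pair k (Encodable.encode l)) (max p N)
  have hi : max p N ≤ i := Nat.right_le_pair _ _
  obtain ⟨t, ht⟩ := exists_isActive hW ((le_max_left p N).trans hi)
  have hm : i ≤ Nat.pair i t := Nat.left_le_pair i t
  obtain ⟨w, hw⟩ := exists_isResponse (hW (Nat.pair i t) ht.1)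
  have hlt : w.unpair.2 % 2 ^ p < l.length := (Nat.mod_lt _ (Nat.two_pow_pos p)).trans_eq hlen.symm
  have hlength : queryLength (Nat.pair i t) = k := by simp only [queryLength, Nat.unpair_pair, i]
  refine ⟨_, List.getElem_mem hlt, Nat.pair i t, by omega, w, ht, hlength, hw, ?_⟩
  rw [querySlot, hlength, Nat.mod_eq_of_lt (hlk _ (List.getElem_mem hlt))]
  simp only [Nat.unpair_pair, i, Encodable.encodek, Option.getD_some]
  exact hl.idxOf_getElem _ hlt

end Game

section Computability

variable {V : ℕ → ℕ → ℕ → Prop} {α : Type*} [Primcodable α] {p m w σ : α → ℕ}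

theorem computablePred_meets (hV : ComputablePred fun x : ℕ × ℕ × ℕ => V x.1 x.2.1 x.2.2)
    (hp : Computable p) (hm : Computable m) (hw : Computable w) :
    ComputablePred fun q => Meets (V (p q)) (m q) (w q) :=
  computablePred_and
    (computablePred_eq (computable_nat_log_two (computable_nat_unpair_snd hw)) hm)
    (computablePred_comp₃ hV hp (computable_nat_unpair_fst hw) (computable_nat_unpair_snd hw))

theorem computablePred_isResponse (hV : ComputablePred fun x : ℕ × ℕ × ℕ => V x.1 x.2.1 x.2.2)
    (hp : Computable p) (hm : Computable m) (hw : Computable w) :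
    ComputablePred fun q => IsResponse (V (p q)) (m q) (w q) :=
  computablePred_isLeast (R := fun q w => Meets (V (p q)) (m q) w)
    (computablePred_meets hV (hp.comp .fst) (hm.comp .fst) .snd) hw

theorem computablePred_isActive (hV : ComputablePred fun x : ℕ × ℕ × ℕ => V x.1 x.2.1 x.2.2)
    (hp : Computable p) (hm : Computable m) :
    ComputablePred fun q => IsActive (V (p q)) (p q) (m q) := by
  refine computablePred_and (computablePred_le hp hm) <| computablePred_isLeast
    (R := fun q t => ∀ k < (m q).unpair.1, ∃ w < t, Meets (V (p q)) (p q + k) w) ?_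
    (computable_nat_unpair_snd hm)
  refine computablePred_forall_lt (α := α × ℕ)
    (R := fun q k => ∃ w < q.2, Meets (V (p q.1)) (p q.1 + k) w)
    ((computable_nat_unpair_fst hm).comp .fst) ?_
  have hp' : Computable fun q : (α × ℕ) × ℕ => p q.1.1 := hp.comp (Computable.fst.comp .fst)
  exact computablePred_exists_lt (α := (α × ℕ) × ℕ)
    (R := fun q w => Meets (V (p q.1.1)) (p q.1.1 + q.2) w) (Computable.snd.comp .fst)
    (computablePred_meets hV (hp'.comp .fst)
      ((Primrec.nat_add.to_comp.comp hp' .snd).comp .fst) .snd)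

theorem computable_queryLength (hm : Computable m) : Computable fun q => queryLength (m q) :=
  computable_nat_unpair_fst (computable_nat_unpair_fst (computable_nat_unpair_fst hm))

theorem computable_querySlot (hm : Computable m) (hσ : Computable σ) :
    Computable fun q => querySlot (m q) (σ q) := by
  have hlist : Computable fun q =>
      (Encodable.decode (m q).unpair.1.unpair.1.unpair.2 : Option (List ℕ)).getD [] :=
    Primrec.option_getD.to_comp.comp (Computable.decode.comp (computable_nat_unpair_snd
      (computable_nat_unpair_fst (computable_nat_unpair_fst hm)))) (.const [])
  exact Primrec.list_idxOf.to_comp.comp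
    (computable_nat_mod hσ (computable_two_pow (computable_queryLength hm))) hlist

end Computability

section Hit

variable {V : ℕ → ℕ → ℕ → Prop} {B : Set ℕ} {p m w σ : ℕ}

/-- The opponent's response `w` to an active block `m` has the residue that the query of the block
asks for when its argument is `σ`. -/
def IsHit (W : ℕ → ℕ → Prop) (p m w σ : ℕ) : Prop :=
  IsActive W p m ∧ IsResponse W m w ∧ querySlot m σ = w.unpair.2 % 2 ^ p

theorem computablePred_isHit (hV : ComputablePred fun x : ℕ × ℕ × ℕ => V x.1 x.2.1 x.2.2)
    {α : Type*} [Primcodable α] {m w σ : α → ℕ} (hm : Computable m) (hw : Computable w)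
    (hσ : Computable σ) : ComputablePred fun q => IsHit (V p) p (m q) (w q) (σ q) :=
  computablePred_and (computablePred_isActive hV (.const p) hm) <| computablePred_and
    (computablePred_isResponse hV (.const p) hm hw) <| computablePred_eq
    (computable_querySlot hm hσ) (computable_nat_mod (computable_nat_unpair_snd hw) (.const _))

/-- If no late block were a hit, the responses would never refute an initial segment of `B`, but
they refute one of any `2 ^ p` strings of the same length, so `B` would be recursive. -/
theorem exists_isHit (hV : ComputablePred fun x : ℕ × ℕ × ℕ => V x.1 x.2.1 x.2.2)
    (hB : ¬ IsRecursive B) (hW : ∀ k ≥ p, ∃ w, Meets (V p) k w) (N : ℕ) :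
    ∃ m ≥ N, ∃ w, IsHit (V p) p m w (initSeg B m) := by
  by_contra! hnot
  let R : ℕ → ℕ → ℕ → Prop := fun k σ y =>
    N ≤ y.unpair.1 ∧ queryLength y.unpair.1 = k ∧ IsHit (V p) p y.unpair.1 y.unpair.2 σ
  have hy : Computable fun x : ℕ × ℕ × ℕ => x.2.2.unpair.1 :=
    computable_nat_unpair_fst (Computable.snd.comp .snd)
  have hR : ComputablePred fun x : ℕ × ℕ × ℕ => R x.1 x.2.1 x.2.2 :=
    computablePred_and (computablePred_le (.const N) hy) <| computablePred_and
      (computablePred_eq (computable_queryLength hy) .fst) <| computablePred_isHit hV hy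
        (computable_nat_unpair_snd (Computable.snd.comp .snd)) (Computable.fst.comp .snd)
  refine hB (isRecursive_of_refuted (M := 2 ^ p) hR ?_ fun k => ?_)
  · rintro _ y ⟨hN, rfl, hact, hresp, hslot⟩
    refine hnot _ hN _ ⟨hact, hresp, ?_⟩
    rwa [← querySlot_mod le_rfl, initSeg_mod_two_pow B (queryLength_le _)]
  · by_contra! hlarge
    have hfin : {σ | σ < 2 ^ k ∧ ∀ y, ¬ R k σ y}.Finite :=
      (Set.finite_Iio (2 ^ k)).subset fun σ hσ => hσ.1
    obtain ⟨S, hS, hcard⟩ := Set.exists_subset_card_eq hlarge.le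
    have hSfin := hfin.subset hS
    obtain ⟨σ, hσ, m, hm, w, hact, hlen, hresp, hslot⟩ := exists_refuted (k := k) hW
      hSfin.toFinset.nodup_toList
      (by rw [Finset.length_toList, ← Set.ncard_eq_toFinset_card S hSfin, hcard])
      (fun σ hσ => (hS (by simpa using hσ)).1) N
    have hσS : σ ∈ S := by simpa using hσ
    refine (hS hσS).2 (Nat.pair m w) ?_
    simpa only [R, Nat.unpair_pair] using ⟨hm, hlen, hact, hresp, hslot⟩

end Hit

/-! ### The two omitted sets -/

section Omitted

variable {V : ℕ → ℕ → ℕ → Prop} {a : ℕ → ℕ → Prop} {A B X : Set ℕ} {p x : ℕ}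

/-- `D` is recursively enumerable in `X`. -/
def IsREIn (X D : Set ℕ) : Prop :=
  ∃ φ : ℕ →. ℕ, Nat.RecursiveIn {oracle X} φ ∧ φ.Dom = D

theorem isREIn_setOf_exists (X : Set ℕ) {R : ℕ → ℕ → ℕ → Prop}
    (hR : ComputablePred fun x : ℕ × ℕ × ℕ => R x.1 x.2.1 x.2.2) :
    IsREIn X {n | ∃ s, R n s (initSeg X s)} :=
  (exists_recursiveIn_search X hR (val := fun _ _ => 0) (.const 0)).imp fun _ h => ⟨h.1, h.2.1⟩

/-- The numbers that the `p`-th requirement keeps out of the set enumerated from `X`: in a block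
where it poses a query, those whose residue answers the query about `X`. Once the response has
arrived, no number but the response is kept out. -/
def queryOmitted (V : ℕ → ℕ → ℕ → Prop) (X : Set ℕ) (p : ℕ) : Set ℕ :=
  {x | IsActive (V p) p (Nat.log 2 x) ∧
    x % 2 ^ p = querySlot (Nat.log 2 x) (initSeg X (Nat.log 2 x)) ∧
    ∀ w, IsResponse (V p) (Nat.log 2 x) w → w.unpair.2 = x}

/-- The numbers that the `p`-th requirement keeps out of the set enumerated from `A`: the
permitted responses. -/
def responseOmitted (V : ℕ → ℕ → ℕ → Prop) (a : ℕ → ℕ → Prop) (A : Set ℕ) (p : ℕ) : Set ℕ :=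
  {x | p ≤ Nat.log 2 x ∧
    ∃ w, IsResponse (V p) (Nat.log 2 x) w ∧ w.unpair.2 = x ∧ Permitted a A (Nat.log 2 x) w}

theorem hasDensityZero_queryOmitted (V : ℕ → ℕ → ℕ → Prop) (X : Set ℕ) (p : ℕ) :
    HasDensityZero (queryOmitted V X p) := by
  by_cases hV : ∀ k, ∃ w, Meets (V p) (p + k) w
  · refine hasDensityZero_of_injOn_log fun x hx y hy hxy => ?_
    obtain ⟨k, hk⟩ := Nat.exists_eq_add_of_le hx.1.1
    obtain ⟨w, hw⟩ := exists_isResponse (hV k)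
    rw [← hk] at hw
    rw [← hx.2.2 w hw, ← hy.2.2 w (hxy ▸ hw)]
  · obtain ⟨k, hk⟩ := not_forall.1 hV
    refine hasDensityZero_of_finite (((finite_isActive hk).preimage' fun m _ => ?_).subset
      fun x hx => hx.1)
    exact (Set.finite_Iio (2 ^ (m + 1))).subset fun x (hx : Nat.log 2 x = m) =>
      Nat.lt_pow_of_log_lt one_lt_two (by omega)

theorem hasDensityZero_iUnion_queryOmitted (V : ℕ → ℕ → ℕ → Prop) (X : Set ℕ) :
    HasDensityZero (⋃ p, queryOmitted V X p) := by
  refine hasDensityZero_iUnion (hasDensityZero_queryOmitted V X) fun p =>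
    ncard_inter_Iio_mul_two_pow_le (fun x hx => hx.1.1) fun x hx y hy hxy => ?_
  rw [hx.2.1, hy.2.1, hxy]

theorem hasDensityZero_iUnion_responseOmitted (V : ℕ → ℕ → ℕ → Prop) (a : ℕ → ℕ → Prop)
    (A : Set ℕ) : HasDensityZero (⋃ p, responseOmitted V a A p) := by
  have hinj (p : ℕ) : (responseOmitted V a A p).InjOn (Nat.log 2) := by
    rintro x ⟨-, w, hw, rfl, -⟩ y ⟨-, w', hw', rfl, -⟩ hxy
    rw [hw.unique (hxy ▸ hw')]
  exact hasDensityZero_iUnion (fun p => hasDensityZero_of_injOn_log (hinj p)) fun p =>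
    ncard_inter_Iio_mul_two_pow_le (fun x hx => hx.1) fun x hx y hy hxy =>
      congrArg (· % 2 ^ p) (hinj p hx hy hxy)

/-- The event `w` shows that `x` is not in `queryOmitted V X p`, where `σ` lists the bits of `X`
that the query is about. -/
def Releases (V : ℕ → ℕ → ℕ → Prop) (p x σ w : ℕ) : Prop :=
  IsActive (V p) p (Nat.log 2 x) → x % 2 ^ p = querySlot (Nat.log 2 x) σ →
    IsResponse (V p) (Nat.log 2 x) w ∧ w.unpair.2 ≠ x

theorem notMem_queryOmitted_iff :
    x ∉ queryOmitted V X p ↔ ∃ w, Releases V p x (initSeg X (Nat.log 2 x)) w := by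
  by_cases hact : IsActive (V p) p (Nat.log 2 x) <;>
    by_cases hslot : x % 2 ^ p = querySlot (Nat.log 2 x) (initSeg X (Nat.log 2 x)) <;>
    simp [queryOmitted, Releases, hact, hslot]

theorem computablePred_releases (hV : ComputablePred fun x : ℕ × ℕ × ℕ => V x.1 x.2.1 x.2.2)
    {α : Type*} [Primcodable α] {p x σ w : α → ℕ} (hp : Computable p) (hx : Computable x)
    (hσ : Computable σ) (hw : Computable w) :
    ComputablePred fun q => Releases V (p q) (x q) (σ q) (w q) :=
  have hlog := computable_nat_log_two hx
  computablePred_imp (computablePred_isActive hV hp hlog) <| computablePred_imp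
    (computablePred_eq (computable_nat_mod hx (computable_two_pow hp))
      (computable_querySlot hlog hσ)) <| computablePred_and
    (computablePred_isResponse hV hp hlog hw)
    (computablePred_eq (computable_nat_unpair_snd hw) hx).not

theorem isREIn_compl_iUnion_queryOmitted
    (hV : ComputablePred fun x : ℕ × ℕ × ℕ => V x.1 x.2.1 x.2.2) (X : Set ℕ) :
    IsREIn X (⋃ p, queryOmitted V X p)ᶜ := by
  have hRE := isREIn_setOf_exists X
    (R := fun x s σ => Nat.log 2 x ≤ s ∧
      ∀ p < Nat.log 2 x + 1, ∃ w < s, Releases V p x (σ % 2 ^ Nat.log 2 x) w) <|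
    computablePred_and (computablePred_le (computable_nat_log_two .fst) (Computable.fst.comp .snd))
      <| computablePred_forall_lt (α := ℕ × ℕ × ℕ)
        (R := fun q p => ∃ w < q.2.1, Releases V p q.1 (q.2.2 % 2 ^ Nat.log 2 q.1) w)
        (Computable.succ.comp (computable_nat_log_two .fst)) <| computablePred_exists_lt
        (R := fun (q : (ℕ × ℕ × ℕ) × ℕ) w =>
          Releases V q.2 q.1.1 (q.1.2.2 % 2 ^ Nat.log 2 q.1.1) w)
        (Computable.fst.comp (Computable.snd.comp .fst)) <|
        computablePred_releases hV (Computable.snd.comp .fst)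
          (Computable.fst.comp (Computable.fst.comp .fst))
          (computable_nat_mod (Computable.snd.comp (Computable.snd.comp (Computable.fst.comp .fst)))
            (computable_two_pow (computable_nat_log_two
              (Computable.fst.comp (Computable.fst.comp .fst))))) .snd
  convert hRE using 1
  ext x
  simp only [Set.mem_compl_iff, Set.mem_iUnion, not_exists, Set.mem_ofPred_eq]
  constructor
  · intro hx
    exact ((eventually_ge_atTop (Nat.log 2 x)).and (eventually_forall_exists_lt fun p _ =>
      notMem_queryOmitted_iff.1 (hx p))).exists.imp fun s hs => by
        rwa [initSeg_mod_two_pow X hs.1]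
  · rintro ⟨s, hs, hrel⟩ p hp
    obtain ⟨w, -, hw⟩ := hrel p (Nat.lt_succ_of_le hp.1.1)
    rw [initSeg_mod_two_pow X hs] at hw
    exact notMem_queryOmitted_iff.2 ⟨w, hw⟩ hp

/-- At the stage `t`, where the string `τ` lists the bits of `A`, the approximation is correct below
`Nat.log 2 x` and no response has been `x`. -/
def IsClear (V : ℕ → ℕ → ℕ → Prop) (a : ℕ → ℕ → Prop) (x t τ : ℕ) : Prop :=
  Nat.log 2 x ≤ t ∧ (∀ i < Nat.log 2 x, (a t i ↔ τ.testBit i = true)) ∧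
    ∀ p < Nat.log 2 x + 1, ∀ w < t + 1, IsResponse (V p) (Nat.log 2 x) w → w.unpair.2 ≠ x

theorem computablePred_isClear (ha : ComputablePred fun q : ℕ × ℕ => a q.1 q.2)
    (hV : ComputablePred fun x : ℕ × ℕ × ℕ => V x.1 x.2.1 x.2.2) :
    ComputablePred fun q : ℕ × ℕ × ℕ => IsClear V a q.1 q.2.1 q.2.2 := by
  have hlog : Computable fun q : ℕ × ℕ × ℕ => Nat.log 2 q.1 := computable_nat_log_two .fst
  have ht : Computable fun q : ℕ × ℕ × ℕ => q.2.1 := Computable.fst.comp .snd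
  refine computablePred_and (computablePred_le hlog ht) <| computablePred_and ?_ ?_
  · exact computablePred_forall_lt (R := fun q i => a q.2.1 i ↔ q.2.2.testBit i = true) hlog <|
      computablePred_iff (computablePred_comp ha ((ht.comp .fst).pair .snd))
        (computablePred_testBit (Computable.snd.comp (Computable.snd.comp .fst)) .snd)
  · refine computablePred_forall_lt (R := fun q p => ∀ w < q.2.1 + 1,
      IsResponse (V p) (Nat.log 2 q.1) w → w.unpair.2 ≠ q.1) (Computable.succ.comp hlog) <|
      computablePred_forall_lt (R := fun (q : (ℕ × ℕ × ℕ) × ℕ) w =>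
        IsResponse (V q.2) (Nat.log 2 q.1.1) w → w.unpair.2 ≠ q.1.1)
        (Computable.succ.comp (ht.comp .fst)) <| computablePred_imp ?_ ?_
    · exact computablePred_isResponse hV (Computable.snd.comp .fst)
        (hlog.comp (Computable.fst.comp .fst)) .snd
    · exact (computablePred_eq (computable_nat_unpair_snd .snd)
        (Computable.fst.comp (Computable.fst.comp .fst))).not

theorem isREIn_compl_iUnion_responseOmitted (ha : ComputablePred fun q : ℕ × ℕ => a q.1 q.2)
    (haA : ∀ n, ∀ᶠ s in atTop, (a s n ↔ n ∈ A))
    (hV : ComputablePred fun x : ℕ × ℕ × ℕ => V x.1 x.2.1 x.2.2) :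
    IsREIn A (⋃ p, responseOmitted V a A p)ᶜ := by
  classical
  convert isREIn_setOf_exists A (computablePred_isClear ha hV) using 1
  ext x
  have hbit {t : ℕ} (ht : Nat.log 2 x ≤ t) {i : ℕ} (hi : i < Nat.log 2 x) :
      (initSeg A t).testBit i = true ↔ i ∈ A := testBit_initSeg A (hi.trans_le ht)
  simp only [Set.mem_compl_iff, Set.mem_iUnion, not_exists, Set.mem_ofPred_eq]
  constructor
  · intro hx
    have hcorrect : ∃ t ≥ Nat.log 2 x, ∀ i < Nat.log 2 x, (a t i ↔ i ∈ A) :=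
      ((eventually_ge_atTop _).and (eventually_forall_lt_iff_mem haA _)).exists
    obtain ⟨ht, hcor⟩ := Nat.find_spec hcorrect
    refine ⟨Nat.find hcorrect, ht, fun i hi => (hcor i hi).trans (hbit ht hi).symm,
      fun p hp w hw hresp hwx => hx p ⟨Nat.le_of_lt_succ hp, w, hresp, hwx, fun t htm hcor' => ?_⟩⟩
    exact (Nat.le_of_lt_succ hw).trans (Nat.find_min' hcorrect ⟨htm, hcor'⟩)
  · rintro ⟨t, ht, hcor, hclear⟩ p ⟨hp, w, hresp, hwx, hperm⟩
    exact hclear p (Nat.lt_succ_of_le hp) w (Nat.lt_succ_of_le (hperm t ht fun i hi =>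
      (hcor i hi).trans (hbit ht hi))) hresp hwx

theorem exists_mem_responseOmitted_inter_queryOmitted
    (ha : ComputablePred fun q : ℕ × ℕ => a q.1 q.2)
    (haA : ∀ n, ∀ᶠ s in atTop, (a s n ↔ n ∈ A))
    (hAB : ¬ Nat.RecursiveIn {oracle B} (oracle A)) (hB : ¬ IsRecursive B)
    (hV : ComputablePred fun x : ℕ × ℕ × ℕ => V x.1 x.2.1 x.2.2)
    (hW : ∀ k ≥ p, ∃ w, Meets (V p) k w) :
    ∃ x ≥ p, (∃ s, V p s x) ∧ x ∈ responseOmitted V a A p ∧ x ∈ queryOmitted V B p := by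
  obtain ⟨m, w, ⟨hact, hresp, hslot⟩, hperm⟩ :
      ∃ m w, IsHit (V p) p m w (initSeg B m) ∧ Permitted a A m w := by
    by_contra! hnot
    exact hAB (recursiveIn_oracle_of_not_permitted ha haA
      (computablePred_isHit hV .fst (Computable.fst.comp .snd) (Computable.snd.comp .snd))
      (exists_isHit hV hB hW) hnot)
  obtain rfl := hresp.log_eq
  exact ⟨w.unpair.2, hact.1.trans (Nat.log_le_self 2 _), ⟨_, hresp.1.2⟩,
    ⟨hact.1, w, hresp, rfl, hperm⟩, hact, hslot.symm,
    fun w' hw' => congrArg (fun w : ℕ => w.unpair.2) (hw'.unique hresp)⟩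

end Omitted

/-! ### Generic computability -/

section Generic

variable {A B C D : Set ℕ}

theorem IsREIn.genericallyComputableIn (hD : IsREIn A D) (hdense : HasDensityOne D)
    (hCD : Disjoint C D) : GenericallyComputableIn A C := by
  obtain ⟨φ, hφ, rfl⟩ := hD
  refine ⟨fun n => φ n >>= fun _ => Part.some 0,
    .comp (recursiveIn_of_computable (.const 0)) hφ, ?_, fun n v hv => ?_⟩
  · convert hdense using 1
    ext n
    simp [PFun.Dom]
  · obtain ⟨u, hu, hv⟩ := Part.mem_bind_iff.1 hv
    have hn : n ∉ C := Set.disjoint_right.1 hCD ((PFun.mem_dom φ n).2 ⟨u, hu⟩)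
    rw [Part.mem_some_iff.1 hv, charFun, if_neg hn]

theorem genericallyComputableIn_of_recursiveIn_oracle (h : Nat.RecursiveIn {oracle A} (oracle C)) :
    GenericallyComputableIn A C := by
  have hdom : (oracle C).Dom = Set.univ := Set.eq_univ_of_forall fun _ => trivial
  refine ⟨oracle C, h, ?_, fun n v hv => Part.mem_some_iff.1 hv⟩
  rw [hdom, hasDensityOne_iff_compl, Set.compl_univ]
  exact hasDensityZero_of_finite Set.finite_empty

theorem recursiveIn_oracle_trans (hAB : Nat.RecursiveIn {oracle B} (oracle A))
    (hCA : Nat.RecursiveIn {oracle A} (oracle C)) : Nat.RecursiveIn {oracle B} (oracle C) :=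
  hCA.subst fun _ hg => Set.mem_singleton_iff.1 hg ▸ hAB

/-- Every bit of `A`, repeated throughout infinitely many dyadic blocks. A set of density one meets
all but finitely many of these blocks, so a generic description gives away all of `A`. -/
def blockCode (A : Set ℕ) : Set ℕ :=
  {x | (Nat.log 2 x).unpair.1 ∈ A}

theorem recursiveIn_oracle_blockCode (A : Set ℕ) :
    Nat.RecursiveIn {oracle A} (oracle (blockCode A)) :=
  (recursiveIn_comp (.oracle _ (Set.mem_singleton _)) (recursiveIn_of_computable
    (computable_nat_unpair_fst (computable_nat_log_two Computable.id)))).of_eq fun _ => rfl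

theorem GenericallyComputable.isRecursive_of_blockCode (h : GenericallyComputable (blockCode A)) :
    IsRecursive A := by
  obtain ⟨φ, hφ, hdense, hA⟩ := h
  obtain ⟨c, rfl⟩ := Code.exists_code.1 hφ
  have hrun : Computable fun q : ℕ × ℕ => Code.evaln q.2.unpair.1 c q.2.unpair.2 :=
    Code.primrec_evaln.to_comp.comp (((computable_nat_unpair_fst .snd).pair (.const c)).pair
      (computable_nat_unpair_snd .snd))
  refine isRecursive_of_search (P := fun n w => (Nat.log 2 w.unpair.2).unpair.1 = n ∧
      (Code.evaln w.unpair.1 c w.unpair.2).isSome = true)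
    (Q := fun _ w => Code.evaln w.unpair.1 c w.unpair.2 = some 1)
    (computablePred_and (computablePred_eq (computable_nat_unpair_fst (computable_nat_log_two
      (computable_nat_unpair_snd .snd))) .fst)
      (computablePred_eq (Primrec.option_isSome.to_comp.comp hrun) (.const true)))
    (computablePred_eq hrun (.const (some 1))) (fun n => ?_) ?_
  · obtain ⟨N, hN⟩ := eventually_atTop.1 hdense.eventually_exists_log_eq
    obtain ⟨x, hx, hlog⟩ := hN (Nat.pair n N) (Nat.right_le_pair n N)
    obtain ⟨v, hv⟩ := (PFun.mem_dom _ _).1 hx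
    obtain ⟨s, hs⟩ := Code.evaln_complete.1 hv
    refine ⟨Nat.pair s x, ?_⟩
    simp only [Nat.unpair_pair, hlog, true_and]
    exact Option.isSome_iff_exists.2 ⟨v, hs⟩
  · rintro _ w ⟨rfl, hw⟩
    obtain ⟨v, hv⟩ := Option.isSome_iff_exists.1 hw
    rw [hv, Option.some_inj, hA _ v (Code.evaln_sound hv)]
    exact charFun_eq_one_iff _

/-- Diagonalization: an injective choice of points of `G` in the domains of the dense codes leaves
room to make the set differ from what each of them says. -/
theorem exists_subset_not_genericallyComputable {G : Set ℕ}
    (hG : ∀ c : Code, HasDensityOne c.eval.Dom → ∃ᶠ x in atTop, x ∈ c.eval.Dom ∧ x ∈ G) :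
    ∃ C ⊆ G, ¬ GenericallyComputable C := by
  let code (e : ℕ) : Code := Denumerable.ofNat Code e
  have hfreq (e : ℕ) : ∃ᶠ x in atTop, HasDensityOne (code e).eval.Dom →
      x ∈ (code e).eval.Dom ∧ x ∈ G := by
    by_cases he : HasDensityOne (code e).eval.Dom
    · exact (hG _ he).mono fun x hx _ => hx
    · exact Frequently.of_forall fun x h => absurd h he
  obtain ⟨f, hf, hfe⟩ := extraction_forall_of_frequently hfreq
  refine ⟨{x | ∃ e, x = f e ∧ x ∈ G ∧ 1 ∉ (code e).eval x}, fun x ⟨_, _, hx, _⟩ => hx, ?_⟩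
  rintro ⟨θ, hθ, hdense, hC⟩
  obtain ⟨c, rfl⟩ := Code.exists_code.1 hθ
  obtain ⟨e, rfl⟩ : ∃ e, code e = c := ⟨_, Denumerable.ofNat_encode c⟩
  obtain ⟨hdom, hfG⟩ := hfe e hdense
  obtain ⟨v, hv⟩ := (PFun.mem_dom _ _).1 hdom
  have hvC := hC _ v hv
  have hmem : v = 1 ↔ 1 ∉ (code e).eval (f e) := by
    rw [hvC, charFun_eq_one_iff]
    constructor
    · rintro ⟨e', he', -, hno⟩
      rwa [← hf.injective he'] at hno
    · exact fun hno => ⟨e, rfl, hfG, hno⟩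
  by_cases hv1 : v = 1
  · exact hmem.1 hv1 (hv1 ▸ hv)
  · exact hv1 (hmem.2 fun h1 => hv1 (Part.mem_unique hv h1))

end Generic

section NotReducible

variable {A B : Set ℕ}

/-- The `e`-th program halts on the input `x` within `s` steps. -/
def HaltsBy (e s x : ℕ) : Prop :=
  (Code.evaln s (Denumerable.ofNat Code e) x).isSome = true

theorem computablePred_haltsBy :
    ComputablePred fun x : ℕ × ℕ × ℕ => HaltsBy x.1.unpair.1 x.2.1 x.2.2 :=
  computablePred_eq (Primrec.option_isSome.to_comp.comp (Code.primrec_evaln.to_comp.comp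
    (((Computable.fst.comp .snd).pair ((Computable.ofNat Code).comp
      (computable_nat_unpair_fst .fst))).pair (Computable.snd.comp .snd)))) (.const true)

theorem mem_dom_eval_iff {c : Code} {x : ℕ} :
    x ∈ c.eval.Dom ↔ ∃ s, HaltsBy (Encodable.encode c) s x := by
  simp only [PFun.mem_dom, HaltsBy, Denumerable.ofNat_encode, Option.isSome_iff_exists,
    Code.evaln_complete]
  exact exists_comm

theorem exists_isREIn_forall_frequently (hA : IsDelta02 A) (hB : ¬ IsRecursive B)
    (hAB : ¬ Nat.RecursiveIn {oracle B} (oracle A)) :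
    ∃ D E, IsREIn A D ∧ HasDensityOne D ∧ IsREIn B E ∧ HasDensityOne E ∧
      ∀ c : Code, HasDensityOne c.eval.Dom →
        ∃ᶠ x in atTop, x ∈ c.eval.Dom ∧ x ∈ Dᶜ ∩ Eᶜ := by
  obtain ⟨a, ha, haA⟩ := hA.exists_approx
  let V (p s x : ℕ) : Prop := HaltsBy p.unpair.1 s x
  refine ⟨_, _, isREIn_compl_iUnion_responseOmitted ha haA (V := V) computablePred_haltsBy,
    hasDensityOne_iff_compl.2 ?_,
    isREIn_compl_iUnion_queryOmitted (V := V) computablePred_haltsBy B,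
    hasDensityOne_iff_compl.2 ?_, fun c hc => frequently_atTop.2 fun K => ?_⟩
  · rw [compl_compl]
    exact hasDensityZero_iUnion_responseOmitted V a A
  · rw [compl_compl]
    exact hasDensityZero_iUnion_queryOmitted V B
  obtain ⟨N, hN⟩ := eventually_atTop.1 hc.eventually_exists_log_eq
  let p := Nat.pair (Encodable.encode c) (max K N)
  have hp : max K N ≤ p := Nat.right_le_pair _ _
  have hV (s x : ℕ) : V p s x ↔ HaltsBy (Encodable.encode c) s x := by
    simp only [V, p, Nat.unpair_pair]
  have hmeets : ∀ k ≥ p, ∃ w, Meets (V p) k w := fun k hk => by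
    obtain ⟨x, hx, hlog⟩ := hN k (by omega)
    obtain ⟨s, hs⟩ := mem_dom_eval_iff.1 hx
    refine ⟨Nat.pair s x, ?_⟩
    simpa only [Meets, Nat.unpair_pair] using ⟨hlog, (hV s x).2 hs⟩
  obtain ⟨x, hpx, ⟨s, hs⟩, hxA, hxB⟩ := exists_mem_responseOmitted_inter_queryOmitted ha haA hAB hB
    (V := V) computablePred_haltsBy hmeets
  refine ⟨x, by omega, mem_dom_eval_iff.2 ⟨s, (hV s x).1 hs⟩, ?_⟩
  simpa only [compl_compl] using ⟨Set.mem_iUnion.2 ⟨p, hxA⟩, Set.mem_iUnion.2 ⟨p, hxB⟩⟩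

end NotReducible

end GenericComputability

open GenericComputability in
theorem mainTheorem5_general (A B : Set ℕ) (hA : IsDelta02 A) : ¬ IsMinimalPair A B := by
  rintro ⟨hA', hB', hmin⟩
  by_cases hAB : Nat.RecursiveIn {oracle B} (oracle A)
  · have hcode := recursiveIn_oracle_blockCode A
    exact hA' (hmin (blockCode A) (genericallyComputableIn_of_recursiveIn_oracle hcode)
      (genericallyComputableIn_of_recursiveIn_oracle
        (recursiveIn_oracle_trans hAB hcode))).isRecursive_of_blockCode
  · obtain ⟨D, E, hD, hD1, hE, hE1, hmeet⟩ := exists_isREIn_forall_frequently hA hB' hAB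
    obtain ⟨C, hCG, hC⟩ := exists_subset_not_genericallyComputable hmeet
    exact hC (hmin C
      (hD.genericallyComputableIn hD1 (Set.disjoint_left.2 fun x hx => (hCG hx).1))
      (hE.genericallyComputableIn hE1 (Set.disjoint_left.2 fun x hx => (hCG hx).2)))

theorem mainTheorem5 (A B : Set ℕ)
    (hA : GenericComputability.IsDelta02 A) (hB : ¬ GenericComputability.IsDelta02 B) :
    ¬ GenericComputability.IsMinimalPair A B :=
  mainTheorem5_general A B hA
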